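/- Let $(\Omega,\Sigma,\mu)$ be an arbitrary measure space with $\mu$ a positive measure, and let $X=L^1(\mu)$ be the Banach space of (classes of) integrable scalar functions, over $\mathbb R$ or $\mathbb C$, canonically embedded in its bidual $X^{**}$. Write $B(\cdot)$ for closed unit balls and $S(\cdot)$ for unit spheres; on $B(X^{**})$ let $w^*=\sigma(X^{**},X^*)$ and let $w=\sigma(X^{**},X^{***})$ be the weak topology of $X^{**}$. Suppose that some $\Lambda\in S(L^1(\mu))$ is a point of continuity of the identity map $id:(B(X^{**}),w^*)\to(B(X^{**}),w)$. Then: 1. $\mu$ has an atom of finite measure, i.e. there is $A\in\Sigma$ with $0<\mu(A)<\infty$ such that every measurable $B\subseteq A$ satisfies $\mu(B)=0$ or $\mu(A\setminus B)=0$. 2. There is $e\in S(L^1(\mu))$ that is an extreme point of $B(L^1(\mu))$, and also an extreme point of $B(X^{**})$, and that is a point of continuity of $id:(B(X^{**}),w^*)\to(B(X^{**}),w)$. -/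

import Mathlib

open MeasureTheory NormedSpace Set

/-- For a normed space `X` over `𝕜`, the functional `f ∈ X*` lies in the closed unit ball `B(X*)` and
is a point of continuity of the identity map `(B(X*), w*) → (B(X*), w)`, where `w* = σ(X*, X)` is the
weak-star topology and `w = σ(X*, X**)` is the weak topology of the Banach space `X*`. -/
def IsWeakStarWeakContinuityPoint (𝕜 : Type*) [RCLike 𝕜] {X : Type*} [NormedAddCommGroup X]
    [NormedSpace 𝕜 X] (f : StrongDual 𝕜 X) : Prop :=
  f ∈ Metric.closedBall (0 : StrongDual 𝕜 X) 1 ∧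
    ContinuousWithinAt
      (fun g : WeakDual 𝕜 X => toWeakSpace 𝕜 (StrongDual 𝕜 X) (WeakDual.toStrongDual g))
      {g : WeakDual 𝕜 X | WeakDual.toStrongDual g ∈ Metric.closedBall (0 : StrongDual 𝕜 X) 1}
      (StrongDual.toWeakDual f)

/-- `A` is an atom of the measure `μ`: it is a measurable set of positive measure such that every
measurable subset of `A` is null or has null complement in `A`. -/
def IsMeasureAtom {Ω : Type*} [MeasurableSpace Ω] (μ : Measure Ω) (A : Set Ω) : Prop :=
  MeasurableSet A ∧ 0 < μ A ∧
    ∀ B : Set Ω, MeasurableSet B → B ⊆ A → μ B = 0 ∨ μ (A \ B) = 0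

open Filter Topology

/-! A continuity point in the weak-star closure of a convex subset of the ball lies in its weak
closure, hence by Mazur in its norm closure (`IsWeakStarWeakContinuityPoint.mem_closure`). Take f of
norm 1 and suppose there are no atoms of finite measure. Then for each ψ in the dual, normalised
restrictions of f to shrinking sets give a singular functional F with Re F ψ ≥ Re ψ f
(`exists_mem_singularBall_re_le`). Thus f is in the weak-star closure of the singular functionals
but at positive norm distance from them, so it is not a continuity point. Conversely, the normalised
indicator of a finite atom spans an L-summand of L¹. This property passes to the bidual and yields
both extremality and continuity. -/

/-! ### Weak-star closures of convex sets. -/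

instance WeakDual.instIsScalarTowerReal {𝕜 X : Type*} [RCLike 𝕜] [NormedAddCommGroup X]
    [NormedSpace 𝕜 X] : IsScalarTower ℝ 𝕜 (WeakDual 𝕜 X) :=
  inferInstanceAs (IsScalarTower ℝ 𝕜 (StrongDual 𝕜 X))

instance WeakDual.instLocallyConvexSpaceReal {𝕜 X : Type*} [RCLike 𝕜] [NormedAddCommGroup X]
    [NormedSpace 𝕜 X] : LocallyConvexSpace ℝ (WeakDual 𝕜 X) :=
  WeakBilin.locallyConvexSpace (𝕜 := 𝕜) (B := topDualPairing 𝕜 X)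

theorem Convex.mem_closure_of_forall_re_le {𝕜 E : Type*} [RCLike 𝕜] [AddCommGroup E]
    [TopologicalSpace E] [IsTopologicalAddGroup E] [Module ℝ E] [Module 𝕜 E] [IsScalarTower ℝ 𝕜 E]
    [ContinuousSMul 𝕜 E] [LocallyConvexSpace ℝ E] {S : Set E} (hS : Convex ℝ S) {f : E}
    (h : ∀ φ : StrongDual 𝕜 E, ∃ g ∈ S, RCLike.re (φ f) ≤ RCLike.re (φ g)) : f ∈ closure S := by
  by_contra hf
  have : ContinuousSMul ℝ E := IsScalarTower.continuousSMul 𝕜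
  obtain ⟨φ, u, hu, huf⟩ := RCLike.geometric_hahn_banach_closed_point (𝕜 := 𝕜)
    hS.closure isClosed_closure hf
  obtain ⟨g, hg, hfg⟩ := h φ
  linarith [hu g (subset_closure hg)]

theorem WeakDual.exists_eval_eq {𝕜 X : Type*} [RCLike 𝕜] [NormedAddCommGroup X]
    [NormedSpace 𝕜 X] (φ : StrongDual 𝕜 (WeakDual 𝕜 X)) :
    ∃ x : X, ∀ g : WeakDual 𝕜 X, φ g = g x := by
  obtain ⟨x, hx⟩ := LinearMap.dualEmbedding_surjective (topDualPairing 𝕜 X) φ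
  exact ⟨x, fun g => (DFunLike.congr_fun hx g).symm⟩

/-- A functional belongs to the weak-star closure of a convex set as soon as no evaluation
separates it from the set. -/
theorem WeakDual.mem_closure_of_convex {𝕜 X : Type*} [RCLike 𝕜] [NormedAddCommGroup X]
    [NormedSpace 𝕜 X] {S : Set (StrongDual 𝕜 X)} (hS : Convex ℝ S) {f : WeakDual 𝕜 X}
    (h : ∀ x : X, ∃ g ∈ S, RCLike.re (f x) ≤ RCLike.re (g x)) :
    f ∈ closure {g : WeakDual 𝕜 X | WeakDual.toStrongDual g ∈ S} := by
  refine Convex.mem_closure_of_forall_re_le (𝕜 := 𝕜) (E := WeakDual 𝕜 X) ?_ ?_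
  · intro a ha b hb s t hs ht hst 
    exact hS ha hb hs ht hst
  · intro φ
    obtain ⟨x, hx⟩ := WeakDual.exists_eval_eq φ
    obtain ⟨g, hg, hfg⟩ := h x
    refine ⟨StrongDual.toWeakDual g, hg, ?_⟩
    rw [hx, hx]
    exact hfg

theorem StrongDual.mem_closedBall_zero_iff {𝕜 X : Type*} [RCLike 𝕜] [NormedAddCommGroup X]
    [NormedSpace 𝕜 X] {f : StrongDual 𝕜 X} {r : ℝ} :
    f ∈ Metric.closedBall (0 : StrongDual 𝕜 X) r ↔ ‖f‖ ≤ r := by simp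

theorem StrongDual.exists_norm_sub_lt_of_mem_closure {𝕜 X : Type*} [RCLike 𝕜]
    [NormedAddCommGroup X] [NormedSpace 𝕜 X] {S : Set (StrongDual 𝕜 X)} {f : StrongDual 𝕜 X}
    (hf : f ∈ closure S) {ε : ℝ} (hε : 0 < ε) : ∃ g ∈ S, ‖g - f‖ < ε := by
  obtain ⟨g, hg, hlt⟩ := (Metric.mem_closure_iff (α := StrongDual 𝕜 X)).mp hf ε hε
  exact ⟨g, hg, by rwa [dist_comm, dist_eq_norm] at hlt⟩

theorem StrongDual.norm_convexComb_le {𝕜 X : Type*} [RCLike 𝕜] [NormedAddCommGroup X]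
    [NormedSpace 𝕜 X] {f g : StrongDual 𝕜 X} {r : ℝ} (hf : ‖f‖ ≤ r) (hg : ‖g‖ ≤ r) {a b : ℝ}
    (ha : 0 ≤ a) (hb : 0 ≤ b) (hab : a + b = 1) : ‖a • f + b • g‖ ≤ r :=
  mem_closedBall_zero_iff.mp (convex_closedBall (0 : StrongDual 𝕜 X) r (mem_closedBall_zero_iff.mpr hf)
    (mem_closedBall_zero_iff.mpr hg) ha hb hab)

theorem IsWeakStarWeakContinuityPoint.mem_closure {𝕜 X : Type*} [RCLike 𝕜] [NormedAddCommGroup X]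
    [NormedSpace 𝕜 X] {f : StrongDual 𝕜 X} (hf : IsWeakStarWeakContinuityPoint 𝕜 f)
    {S : Set (StrongDual 𝕜 X)} (hS : Convex ℝ S) (hball : S ⊆ Metric.closedBall 0 1)
    (h : ∀ x : X, ∃ g ∈ S, RCLike.re (f x) ≤ RCLike.re (g x)) : f ∈ closure S := by
  set T : Set (WeakDual 𝕜 X) := {g | WeakDual.toStrongDual g ∈ S} with hT
  have h1 : StrongDual.toWeakDual f ∈ closure T :=
    WeakDual.mem_closure_of_convex hS fun x => h x
  have h2 := (hf.2.mono (fun g hg => hball hg : T ⊆ _)).mem_closure_image h1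
  have h3 : (fun g : WeakDual 𝕜 X => toWeakSpace 𝕜 (StrongDual 𝕜 X) (WeakDual.toStrongDual g)) '' T
      = toWeakSpace 𝕜 (StrongDual 𝕜 X) '' S := by
    ext y
    constructor
    · rintro ⟨g, hg, rfl⟩
      exact ⟨_, hg, rfl⟩
    · rintro ⟨g, hg, rfl⟩
      exact ⟨StrongDual.toWeakDual g, hg, rfl⟩
  -- Mazur: weak and norm closures of a convex set coincide.
  rw [h3, ← hS.toWeakSpace_closure 𝕜] at h2
  obtain ⟨y, hy, hyf⟩ := h2
  have : y = f := (toWeakSpace 𝕜 (StrongDual 𝕜 X)).injective hyf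
  exact this ▸ hy

/-! ### One-dimensional L-summands. -/

/-- If `e` spans an `L`-summand of `X` with coordinate functional `χ`, then the image of `e` in the
bidual has the same property. -/
theorem norm_sub_smul_inclusionInDoubleDual_le {𝕜 X : Type*} [RCLike 𝕜] [NormedAddCommGroup X]
    [NormedSpace 𝕜 X] {e : X} {χ : StrongDual 𝕜 X}
    (hL : ∀ x, ‖χ x‖ + ‖x - χ x • e‖ ≤ ‖x‖) {F : StrongDual 𝕜 (StrongDual 𝕜 X)} (hF : ‖F‖ ≤ 1) :
    ‖F - F χ • inclusionInDoubleDual 𝕜 X e‖ ≤ 1 - ‖F χ‖ := by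
  have hχ : ‖χ‖ ≤ 1 := χ.opNorm_le_bound zero_le_one fun x => by
    linarith [hL x, norm_nonneg (x - χ x • e)]
  have hFχ : ‖F χ‖ ≤ 1 := (F.le_opNorm χ).trans (by nlinarith [norm_nonneg F, norm_nonneg χ])
  refine ContinuousLinearMap.opNorm_le_bound _ (by linarith) fun ψ => ?_
  obtain ⟨u, hu, hub⟩ := RCLike.exists_norm_eq_mul_self (F χ)
  obtain ⟨v, hv, hva⟩ := RCLike.exists_norm_eq_mul_self (F ψ - F χ * ψ e)
  have hv0 : v ≠ 0 := norm_ne_zero_iff.mp (by rw [hv]; exact one_ne_zero)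
  -- Replacing the value of ψ at e by any c with |c| ≤ ‖ψ‖ keeps the norm at most ‖ψ‖. This phase
  -- aligns the two terms of F at the new functional, so their moduli add.
  set c : 𝕜 := ‖ψ‖ * (v⁻¹ * u) with hc
  have hcn : ‖c‖ = ‖ψ‖ := by simp [hc, hu, hv]
  have hbound : ‖ψ - ψ e • χ + c • χ‖ ≤ ‖ψ‖ := by
    refine ContinuousLinearMap.opNorm_le_bound _ (norm_nonneg _) fun x => ?_
    have h1 : (ψ - ψ e • χ + c • χ) x = ψ (x - χ x • e) + c * χ x := by
      simp [mul_comm]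
    calc ‖(ψ - ψ e • χ + c • χ) x‖ ≤ ‖ψ (x - χ x • e)‖ + ‖c * χ x‖ := by
          rw [h1]; exact norm_add_le _ _
      _ ≤ ‖ψ‖ * ‖x - χ x • e‖ + ‖ψ‖ * ‖χ x‖ :=
          add_le_add (ψ.le_opNorm _) (by rw [norm_mul, hcn])
      _ = ‖ψ‖ * (‖χ x‖ + ‖x - χ x • e‖) := by ring
      _ ≤ ‖ψ‖ * ‖x‖ := mul_le_mul_of_nonneg_left (hL x) (norm_nonneg _)
  have hFb : ‖F (ψ - ψ e • χ + c • χ)‖ ≤ ‖ψ‖ :=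
    (F.le_opNorm _).trans (by nlinarith [norm_nonneg F, norm_nonneg (ψ - ψ e • χ + c • χ)])
  have hval : v * F (ψ - ψ e • χ + c • χ) =
      ((‖F ψ - F χ * ψ e‖ + ‖ψ‖ * ‖F χ‖ : ℝ) : 𝕜) := by
    have h1 : F (ψ - ψ e • χ + c • χ) = (F ψ - F χ * ψ e) + c * F χ := by
      simp [mul_comm]
    push_cast
    rw [h1, hc]
    have hvv : v * v⁻¹ = 1 := mul_inv_cancel₀ hv0
    linear_combination -hva - (‖ψ‖ : 𝕜) * hub + (‖ψ‖ : 𝕜) * u * F χ * hvv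
  have hnorm : ‖F (ψ - ψ e • χ + c • χ)‖ = ‖F ψ - F χ * ψ e‖ + ‖ψ‖ * ‖F χ‖ := by
    rw [← one_mul ‖F _‖, ← hv, ← norm_mul, hval, RCLike.norm_ofReal, abs_of_nonneg (by positivity)]
  have happ : (F - F χ • inclusionInDoubleDual 𝕜 X e) ψ = F ψ - F χ * ψ e := rfl
  rw [happ]
  linarith

/-- On the ball, ‖g - f‖ ≤ (1 - |g x|) + |g x - 1| ‖f‖, so convergence of g at the single point x
already forces norm convergence. -/
theorem isWeakStarWeakContinuityPoint_of_norm_sub_le {𝕜 X : Type*} [RCLike 𝕜] [NormedAddCommGroup X]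
    [NormedSpace 𝕜 X] {f : StrongDual 𝕜 X} (hf : ‖f‖ ≤ 1) {x : X} (hfx : f x = 1)
    (h : ∀ g : StrongDual 𝕜 X, ‖g‖ ≤ 1 → ‖g - g x • f‖ ≤ 1 - ‖g x‖) :
    IsWeakStarWeakContinuityPoint 𝕜 f := by
  refine ⟨by simpa using hf, ?_⟩
  have hx : Tendsto (fun g : WeakDual 𝕜 X => g x) (𝓝 (StrongDual.toWeakDual f)) (𝓝 1) := by
    have := (WeakDual.eval_continuous (𝕜 := 𝕜) x).tendsto (StrongDual.toWeakDual f)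
    rwa [StrongDual.toWeakDual_apply, hfx] at this
  set S := {g : WeakDual 𝕜 X | WeakDual.toStrongDual g ∈ Metric.closedBall (0 : StrongDual 𝕜 X) 1}
  have hx' := hx.mono_left (nhdsWithin_le_nhds (s := S))
  have hlim : Tendsto (fun g : WeakDual 𝕜 X => WeakDual.toStrongDual g)
      (𝓝[S] (StrongDual.toWeakDual f)) (𝓝 f) := by
    rw [tendsto_iff_norm_sub_tendsto_zero]
    have hb : Tendsto (fun g : WeakDual 𝕜 X => (1 - ‖g x‖) + ‖g x - 1‖ * ‖f‖)
        (𝓝[S] (StrongDual.toWeakDual f)) (𝓝 ((1 - ‖(1 : 𝕜)‖) + ‖(1 : 𝕜) - 1‖ * ‖f‖)) :=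
      (tendsto_const_nhds.sub hx'.norm).add ((hx'.sub tendsto_const_nhds).norm.mul_const _)
    simp only [norm_one, sub_self, norm_zero, zero_mul, add_zero] at hb
    refine squeeze_zero' (Eventually.of_forall fun _ => norm_nonneg _) ?_ hb
    filter_upwards [self_mem_nhdsWithin] with g hg
    have hg1 : ‖WeakDual.toStrongDual g‖ ≤ 1 := by simpa [S] using hg
    have := h _ hg1
    rw [WeakDual.toStrongDual_apply] at this
    calc ‖WeakDual.toStrongDual g - f‖
        = ‖(WeakDual.toStrongDual g - g x • f) + (g x - 1) • f‖ := by
          congr 1; ext y; simp [sub_mul]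
      _ ≤ _ := (norm_add_le _ _).trans (add_le_add this (norm_smul _ _).le)
  exact ((toWeakSpaceCLM 𝕜 (StrongDual 𝕜 X)).continuous.tendsto f).comp hlim

/-- Since |χ| ≤ 1 on the ball and χ e = 1, the endpoints of a segment through e also have χ = 1, and
then `h` leaves them no distance from e. -/
theorem mem_extremePoints_of_norm_sub_le {𝕜 X : Type*} [RCLike 𝕜] [NormedAddCommGroup X]
    [NormedSpace 𝕜 X] [SMul ℝ X] [IsScalarTower ℝ 𝕜 X] {e : X} (he : ‖e‖ ≤ 1)
    (χ : StrongDual 𝕜 X) (hχe : χ e = 1)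
    (h : ∀ x : X, ‖x‖ ≤ 1 → ‖x - χ x • e‖ ≤ 1 - ‖χ x‖) :
    e ∈ extremePoints ℝ (Metric.closedBall (0 : X) 1) := by
  have hχ : ∀ x : X, ‖x‖ ≤ 1 → ‖χ x‖ ≤ 1 := fun x hx => by
    linarith [h x hx, norm_nonneg (x - χ x • e)]
  refine ⟨by simpa using he, fun x hx y hy hxy => ?_⟩
  rw [mem_closedBall_zero_iff] at hx hy
  obtain ⟨a, b, ha, hb, hab, rfl⟩ := hxy
  have hsc : ∀ (r : ℝ) (z : X), χ (r • z) = r • χ z := fun r z => by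
    rw [← smul_one_smul 𝕜 r z, map_smul, smul_assoc, one_smul]
  have h1 : a * RCLike.re (χ x) + b * RCLike.re (χ y) = 1 := by
    have := congrArg RCLike.re hχe
    simpa [hsc, RCLike.smul_re] using this
  have hx1 := (RCLike.re_le_norm (χ x)).trans (hχ x hx)
  have hy1 := (RCLike.re_le_norm (χ y)).trans (hχ y hy)
  have hxe : RCLike.re (χ x) = 1 := by nlinarith
  have hx2 : χ x = 1 := by
    have hn : ‖χ x‖ = 1 := le_antisymm (hχ x hx) (hxe ▸ RCLike.re_le_norm _)
    rw [← RCLike.re_eq_self_of_le (hn.trans hxe.symm).le, hxe, RCLike.ofReal_one]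
  have := h x hx
  rw [hx2, one_smul, norm_one, sub_self] at this
  exact eq_of_sub_eq_zero (norm_le_zero_iff.mp this)

theorem StrongDual.mem_extremePoints_of_norm_sub_le {𝕜 X : Type*} [RCLike 𝕜]
    [NormedAddCommGroup X] [NormedSpace 𝕜 X] {f : StrongDual 𝕜 X} (hf : ‖f‖ ≤ 1) {x : X}
    (hfx : f x = 1) (h : ∀ g : StrongDual 𝕜 X, ‖g‖ ≤ 1 → ‖g - g x • f‖ ≤ 1 - ‖g x‖) :
    f ∈ extremePoints ℝ (Metric.closedBall (0 : StrongDual 𝕜 X) 1) :=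
  _root_.mem_extremePoints_of_norm_sub_le hf (inclusionInDoubleDual 𝕜 _ x) hfx h

/-! ### Atoms of finite measure in L¹. -/

/-- Preimages of Borel sets are null or conull in the atom, and countably many Borel sets separate
the points of β. -/
theorem IsMeasureAtom.exists_ae_eq_const {Ω β : Type*} [MeasurableSpace Ω] {μ : Measure Ω}
    {A : Set Ω} (hA : IsMeasureAtom μ A) [TopologicalSpace β] [SecondCountableTopology β]
    [TopologicalSpace.PseudoMetrizableSpace β] [T0Space β] [MeasurableSpace β] [BorelSpace β]
    [Nonempty β]
    {f : Ω → β} (hf : AEStronglyMeasurable f μ) : ∃ c, f =ᵐ[μ.restrict A] fun _ => c := by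
  obtain ⟨g, hg, hfg⟩ := hf
  have hfg' : f =ᵐ[μ.restrict A] g := ae_restrict_of_ae hfg
  suffices h : ∃ c, g =ᵐ[μ.restrict A] Function.const Ω c by
    obtain ⟨c, hc⟩ := h
    exact ⟨c, hfg'.trans hc⟩
  refine exists_eventuallyEq_const_of_forall_separating MeasurableSet fun U hU => ?_
  have hgU : MeasurableSet (g ⁻¹' U) := hg.measurable hU
  rcases hA.2.2 (A ∩ g ⁻¹' U) (hA.1.inter hgU) inter_subset_left with h | h
  · right
    rw [ae_restrict_iff' hA.1, ae_iff]
    convert h using 2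
    ext x; simp
  · left
    rw [ae_restrict_iff' hA.1, ae_iff]
    convert h using 2
    ext x; simp

/-- Integration over a measurable set, as a continuous linear functional on `L¹`. -/
noncomputable def setIntegralL1 (𝕜 : Type*) [RCLike 𝕜] {Ω : Type*} [MeasurableSpace Ω]
    (μ : Measure Ω) (A : Set Ω) : StrongDual 𝕜 (Lp 𝕜 1 μ) :=
  LinearMap.mkContinuous
    { toFun := fun f => ∫ x in A, f x ∂μ
      map_add' := fun f g => by
        rw [← integral_add (L1.integrable_coeFn f).integrableOn
          (L1.integrable_coeFn g).integrableOn]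
        exact integral_congr_ae (ae_restrict_of_ae (Lp.coeFn_add f g))
      map_smul' := fun c f => by
        rw [RingHom.id_apply, ← integral_smul]
        exact integral_congr_ae (ae_restrict_of_ae (Lp.coeFn_smul c f)) } 1 fun f => by
    rw [one_mul, L1.norm_eq_integral_norm]
    exact (norm_integral_le_integral_norm _).trans (setIntegral_le_integral
      (L1.integrable_coeFn f).norm (Eventually.of_forall fun _ => norm_nonneg _))

theorem setIntegralL1_apply {𝕜 : Type*} [RCLike 𝕜] {Ω : Type*} [MeasurableSpace Ω]
    (μ : Measure Ω) (A : Set Ω) (f : Lp 𝕜 1 μ) : setIntegralL1 𝕜 μ A f = ∫ x in A, f x ∂μ := rfl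

/-- As f is a.e. constant on A, the subtracted term is exactly f on A; the L¹ norm is additive over
A and its complement. -/
theorem IsMeasureAtom.norm_setIntegralL1_add_norm_sub {𝕜 : Type*} [RCLike 𝕜] {Ω : Type*}
    [MeasurableSpace Ω] {μ : Measure Ω} {A : Set Ω} (hA : IsMeasureAtom μ A) (hfin : μ A ≠ ⊤)
    (f : Lp 𝕜 1 μ) :
    ‖setIntegralL1 𝕜 μ A f‖ + ‖f - setIntegralL1 𝕜 μ A f •
      indicatorConstLp 1 hA.1 hfin ((μ.real A : 𝕜)⁻¹)‖ = ‖f‖ := by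
  have hm : μ.real A ≠ 0 := (ENNReal.toReal_pos hA.2.1.ne' hfin).ne'
  obtain ⟨c, hc⟩ := hA.exists_ae_eq_const (Lp.aestronglyMeasurable f)
  have hint : ∫ x in A, f x ∂μ = μ.real A * c := by
    rw [integral_congr_ae hc, setIntegral_const, RCLike.real_smul_eq_coe_mul]
  have hintn : ∫ x in A, ‖f x‖ ∂μ = μ.real A * ‖c‖ := by
    rw [integral_congr_ae (hc.mono fun x hx => congrArg norm hx : (fun x => ‖f x‖) =ᵐ[_] fun _ => ‖c‖), setIntegral_const, smul_eq_mul]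
  set g := f - setIntegralL1 𝕜 μ A f • indicatorConstLp 1 hA.1 hfin ((μ.real A : 𝕜)⁻¹) with hg
  have hgf : g =ᵐ[μ] fun x => f x - A.indicator (fun _ => c) x := by
    filter_upwards [Lp.coeFn_sub f (setIntegralL1 𝕜 μ A f •
        indicatorConstLp 1 hA.1 hfin ((μ.real A : 𝕜)⁻¹)),
      Lp.coeFn_smul (setIntegralL1 𝕜 μ A f) (indicatorConstLp 1 hA.1 hfin ((μ.real A : 𝕜)⁻¹)),
      indicatorConstLp_coeFn (p := 1) (hs := hA.1) (hμs := hfin) (c := ((μ.real A : 𝕜)⁻¹))]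
      with x h1 h2 h3
    rw [hg, h1, Pi.sub_apply, h2, Pi.smul_apply, h3, setIntegralL1_apply, hint]
    by_cases hx : x ∈ A
    · have : (μ.real A : 𝕜) ≠ 0 := by exact_mod_cast hm
      simp only [hx, indicator_of_mem, smul_eq_mul]
      field_simp
    · simp [hx]
  have hgA : ∫ x in A, ‖g x‖ ∂μ = 0 := by
    rw [← integral_zero Ω ℝ (μ := μ.restrict A)]
    refine integral_congr_ae ?_
    filter_upwards [ae_restrict_of_ae hgf, hc, ae_restrict_mem hA.1] with x h1 h2 h3
    simp [h1, h2, h3]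
  have hgAc : ∫ x in Aᶜ, ‖g x‖ ∂μ = ∫ x in Aᶜ, ‖f x‖ ∂μ := by
    refine integral_congr_ae ?_
    filter_upwards [ae_restrict_of_ae hgf, ae_restrict_mem hA.1.compl] with x h1 h3
    rw [h1, indicator_of_notMem h3, sub_zero]
  rw [setIntegralL1_apply, hint, L1.norm_eq_integral_norm, L1.norm_eq_integral_norm,
    ← integral_add_compl hA.1 (L1.integrable_coeFn g).norm,
    ← integral_add_compl hA.1 (L1.integrable_coeFn f).norm, hgA, hgAc, hintn, norm_mul,
    RCLike.norm_ofReal, abs_of_nonneg measureReal_nonneg, zero_add]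

theorem IsMeasureAtom.exists_extremePoint {𝕜 : Type*} [RCLike 𝕜] {Ω : Type*} [MeasurableSpace Ω]
    {μ : Measure Ω} {A : Set Ω} (hA : IsMeasureAtom μ A) (hfin : μ A ≠ ⊤) :
    ∃ e : Lp 𝕜 1 μ, ‖e‖ = 1 ∧
      e ∈ extremePoints ℝ (Metric.closedBall (0 : Lp 𝕜 1 μ) 1) ∧
      inclusionInDoubleDual 𝕜 (Lp 𝕜 1 μ) e ∈
        extremePoints ℝ
          (Metric.closedBall (0 : StrongDual 𝕜 (StrongDual 𝕜 (Lp 𝕜 1 μ))) 1) ∧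
      IsWeakStarWeakContinuityPoint 𝕜 (inclusionInDoubleDual 𝕜 (Lp 𝕜 1 μ) e) := by
  have hm : μ.real A ≠ 0 := (ENNReal.toReal_pos hA.2.1.ne' hfin).ne'
  have hm' : (μ.real A : 𝕜) ≠ 0 := by exact_mod_cast hm
  set e : Lp 𝕜 1 μ := indicatorConstLp 1 hA.1 hfin ((μ.real A : 𝕜)⁻¹) with he
  set χ := setIntegralL1 𝕜 μ A with hχ
  have hL : ∀ x, ‖χ x‖ + ‖x - χ x • e‖ = ‖x‖ := hA.norm_setIntegralL1_add_norm_sub hfin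
  have hχe : χ e = 1 := by
    rw [hχ, setIntegralL1_apply, integral_congr_ae (g := fun _ => (μ.real A : 𝕜)⁻¹),
      setIntegral_const, RCLike.real_smul_eq_coe_mul, mul_inv_cancel₀ hm']
    filter_upwards [ae_restrict_of_ae (indicatorConstLp_coeFn (p := 1) (hs := hA.1)
      (hμs := hfin) (c := ((μ.real A : 𝕜)⁻¹))), ae_restrict_mem hA.1] with x h1 h2
    rw [h1, indicator_of_mem h2]
  have hne : ‖e‖ = 1 := by
    have := hL e
    rw [hχe, one_smul, sub_self, norm_zero, norm_one, add_zero] at this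
    exact this.symm
  have hnι : ‖inclusionInDoubleDual 𝕜 (Lp 𝕜 1 μ) e‖ ≤ 1 :=
    (double_dual_bound 𝕜 _ e).trans hne.le
  have hF : ∀ F : StrongDual 𝕜 (StrongDual 𝕜 (Lp 𝕜 1 μ)), ‖F‖ ≤ 1 →
      ‖F - F χ • inclusionInDoubleDual 𝕜 (Lp 𝕜 1 μ) e‖ ≤ 1 - ‖F χ‖ := fun F h =>
    norm_sub_smul_inclusionInDoubleDual_le (fun x => (hL x).le) h
  refine ⟨e, hne, ?_, ?_, ?_⟩
  · exact mem_extremePoints_of_norm_sub_le hne.le χ hχe fun x hx => by linarith [hL x]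
  · exact StrongDual.mem_extremePoints_of_norm_sub_le hnι (x := χ) hχe hF
  · exact isWeakStarWeakContinuityPoint_of_norm_sub_le hnι (x := χ) hχe hF

/-! ### Exhaustion for an atomless finite measure. -/

/-- If `ν` is a finite measure without atoms and `σ` is a finitely additive set function dominated
by `ν` with `0 ≤ σ univ`, then `σ` is nonnegative along a decreasing sequence of non-null sets whose
measures tend to `0`. -/
theorem MeasureTheory.exists_antitone_measureReal_tendsto_zero {Ω : Type*} [MeasurableSpace Ω]
    {ν : Measure Ω} [IsFiniteMeasure ν] (hν : 0 < ν.real univ)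
    (hsplit : ∀ A, MeasurableSet A → 0 < ν.real A →
      ∃ B ⊆ A, MeasurableSet B ∧ 0 < ν.real B ∧ 0 < ν.real (A \ B))
    {σ : Set Ω → ℝ} {C : ℝ}
    (hadd : ∀ A B, MeasurableSet A → MeasurableSet B → Disjoint A B → σ (A ∪ B) = σ A + σ B)
    (hbound : ∀ A, MeasurableSet A → |σ A| ≤ C * ν.real A) (hσ : 0 ≤ σ univ) :
    ∃ A : ℕ → Set Ω, Antitone A ∧
      (∀ n, MeasurableSet (A n) ∧ 0 < ν.real (A n) ∧ 0 ≤ σ (A n)) ∧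
      Tendsto (fun n => ν.real (A n)) atTop (𝓝 0) := by
  let P : Set Ω → Prop := fun A => MeasurableSet A ∧ 0 < ν.real A ∧ 0 ≤ σ A
  -- Greedy choice: B has nearly the least measure among admissible subsets of A.
  have hstep : ∀ (n : ℕ) (A : {A // P A}), ∃ B : {A // P A}, B.1 ⊆ A.1 ∧
      ∀ D ⊆ A.1, P D → ν.real B.1 ≤ ν.real D + 1 / ((n : ℝ) + 1) := by
    intro n A
    set T : Set ℝ := {r | ∃ D ⊆ A.1, P D ∧ ν.real D = r}
    have hT : T.Nonempty := ⟨_, A.1, Subset.rfl, A.2, rfl⟩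
    have hTb : BddBelow T := ⟨0, by rintro _ ⟨D, -, -, rfl⟩; exact measureReal_nonneg⟩
    obtain ⟨_, ⟨B, hBA, hB, rfl⟩, hlt⟩ := Real.lt_sInf_add_pos hT
      (ε := 1 / ((n : ℝ) + 1)) (by positivity)
    exact ⟨⟨B, hB⟩, hBA, fun D hD hPD =>
      hlt.le.trans (by gcongr; exact csInf_le hTb ⟨D, hD, hPD, rfl⟩)⟩
  choose F hFsub hFmin using hstep
  let A : ℕ → {A // P A} := fun n => Nat.rec ⟨univ, .univ, hν, hσ⟩ F n
  have hA : ∀ n, A (n + 1) = F n (A n) := fun _ => rfl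
  have hanti : Antitone fun n => (A n).1 := antitone_nat_of_succ_le fun n => by
    simpa only [hA] using hFsub n (A n)
  have hAm : ∀ n, MeasurableSet (A n).1 := fun n => (A n).2.1
  refine ⟨fun n => (A n).1, hanti, fun n => (A n).2, ?_⟩
  set L := ⋂ n, (A n).1 with hL
  have hLm : MeasurableSet L := .iInter hAm
  have hLA : ∀ n, L ⊆ (A n).1 := fun n => iInter_subset _ n
  have hlim : Tendsto (fun n => ν.real (A n).1) atTop (𝓝 (ν.real L)) :=
    (ENNReal.tendsto_toReal (measure_ne_top _ _)).comp (tendsto_measure_iInter_atTop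
      (fun n => (hAm n).nullMeasurableSet) hanti ⟨0, measure_ne_top _ _⟩)
  suffices hL0 : ν.real L = 0 by rwa [hL0] at hlim
  by_contra hL0
  have hLpos : 0 < ν.real L := lt_of_le_of_ne measureReal_nonneg (Ne.symm hL0)
  -- Domination by ν makes σ continuous along the sequence, so the sign survives the intersection.
  have hσL : 0 ≤ σ L := by
    have h1 : ∀ n, σ L ≥ - (C * (ν.real (A n).1 - ν.real L)) := fun n => by
      have h2 := hadd L ((A n).1 \ L) hLm ((hAm n).diff hLm) disjoint_sdiff_right
      rw [union_sdiff_cancel (hLA n)] at h2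
      have h3 := (abs_le.mp (hbound _ ((hAm n).diff hLm))).2
      rw [measureReal_sdiff (hLA n) hLm] at h3
      linarith [(A n).2.2.2]
    have h4 : Tendsto (fun n => - (C * (ν.real (A n).1 - ν.real L))) atTop
        (𝓝 (-(C * (ν.real L - ν.real L)))) :=
      ((hlim.sub tendsto_const_nhds).const_mul C).neg
    simpa using le_of_tendsto' h4 h1
  -- Of the two pieces of L, one has σ ≥ 0 and strictly smaller measure, against near-minimality.
  obtain ⟨D, hDL, hPD, hDlt⟩ : ∃ D ⊆ L, P D ∧ ν.real D < ν.real L := by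
    obtain ⟨B, hBL, hB, hB0, hLB0⟩ := hsplit L hLm hLpos
    have h1 := hadd B (L \ B) hB (hLm.diff hB) disjoint_sdiff_right
    rw [union_sdiff_cancel hBL] at h1
    have h2 := measureReal_sdiff (μ := ν) hBL hB
    rcases le_total 0 (σ B) with h | h
    · exact ⟨B, hBL, ⟨hB, hB0, h⟩, by linarith⟩
    · exact ⟨L \ B, sdiff_subset, ⟨hLm.diff hB, hLB0, by linarith⟩, by linarith⟩
  have h1 : Tendsto (fun n : ℕ => ν.real D + 1 / ((n : ℝ) + 1)) atTop (𝓝 (ν.real D + 0)) :=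
    tendsto_const_nhds.add tendsto_one_div_add_atTop_nhds_zero_nat
  have h2 := le_of_tendsto_of_tendsto' (hlim.comp (tendsto_add_atTop_nat 1)) h1 fun n =>
    hFmin n (A n) D (hDL.trans (hLA n)) hPD
  linarith

/-! ### Singular functionals in the bidual of L¹. -/

section Singular

variable {𝕜 : Type*} [RCLike 𝕜] {Ω : Type*} [MeasurableSpace Ω] {μ : Measure Ω}

/-- The measure with density `‖f‖`. -/
noncomputable def normMeasure (f : Lp 𝕜 1 μ) : Measure Ω := μ.withDensity fun x => ‖f x‖ₑ

theorem normMeasure_apply (f : Lp 𝕜 1 μ) {A : Set Ω} (hA : MeasurableSet A) :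
    normMeasure f A = ∫⁻ x in A, ‖f x‖ₑ ∂μ := withDensity_apply _ hA

instance (f : Lp 𝕜 1 μ) : IsFiniteMeasure (normMeasure f) :=
  isFiniteMeasure_withDensity (L1.integrable_coeFn f).2.ne

theorem normMeasure_real_univ (f : Lp 𝕜 1 μ) : (normMeasure f).real univ = ‖f‖ := by
  rw [measureReal_def, normMeasure_apply f .univ, Measure.restrict_univ, L1.norm_def]

theorem normMeasure_ne_zero (f : Lp 𝕜 1 μ) {A : Set Ω} (hA : MeasurableSet A)
    (h : μ A ≠ 0) (hf : ∀ x ∈ A, f x ≠ 0) : normMeasure f A ≠ 0 := by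
  rw [normMeasure_apply f hA, Ne, lintegral_eq_zero_iff' (Lp.aestronglyMeasurable f).enorm.restrict]
  intro h0
  have : ∀ᵐ x ∂μ.restrict A, False := by
    filter_upwards [h0, ae_restrict_mem hA] with x h1 h2
    exact hf x h2 (by simpa using h1)
  rw [eventually_false_iff_eq_bot, ae_eq_bot, Measure.restrict_eq_zero] at this
  exact h this

/-- If `μ` has no atom of finite measure, then the measure with density `‖f‖` has no atoms. -/
theorem normMeasure_exists_split (hμ : ¬ ∃ A : Set Ω, IsMeasureAtom μ A ∧ μ A < ⊤) (f : Lp 𝕜 1 μ)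
    {A : Set Ω} (hA : MeasurableSet A) (h0 : 0 < (normMeasure f).real A) :
    ∃ B ⊆ A, MeasurableSet B ∧ 0 < (normMeasure f).real B ∧ 0 < (normMeasure f).real (A \ B) := by
  have hfm : Measurable f := (Lp.stronglyMeasurable f).measurable
  -- Integrability makes these sets μ-finite, so the hypothesis on atoms applies although μ is
  -- arbitrary.
  let E : ℕ → Set Ω := fun n => A ∩ {x | 1 / ((n : ℝ) + 1) ≤ ‖f x‖}
  have hE : ∀ n, MeasurableSet (E n) := fun n =>
    hA.inter (measurableSet_le measurable_const hfm.norm)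
  have hEfin : ∀ n, μ (E n) < ⊤ := fun n =>
    (measure_mono inter_subset_right).trans_lt
      ((L1.integrable_coeFn f).measure_norm_ge_lt_top (by positivity))
  have hEf : ∀ n, ∀ x ∈ E n, f x ≠ 0 := fun n x hx => by
    have h1 : 1 / ((n : ℝ) + 1) ≤ ‖f x‖ := hx.2
    exact norm_pos_iff.mp (lt_of_lt_of_le (by positivity) h1)
  obtain ⟨n, hn⟩ : ∃ n, μ (E n) ≠ 0 := by
    by_contra! hall
    have hU : μ (⋃ n, E n) = 0 := measure_iUnion_null hall
    have hz : normMeasure f A = 0 := by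
      rw [normMeasure_apply f hA,
        lintegral_eq_zero_iff' (Lp.aestronglyMeasurable f).enorm.restrict]
      have hae : ∀ᵐ x ∂μ, x ∉ ⋃ n, E n := measure_eq_zero_iff_ae_notMem.mp hU
      filter_upwards [ae_restrict_of_ae hae, ae_restrict_mem hA] with x h1 h2
      by_contra hx
      have hpos : 0 < ‖f x‖ := norm_pos_iff.mpr (by simpa using hx)
      obtain ⟨m, hm⟩ := exists_nat_one_div_lt hpos
      exact h1 (mem_iUnion.mpr ⟨m, h2, hm.le⟩)
    rw [measureReal_def, hz] at h0
    exact lt_irrefl _ h0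
  have hnot : ¬ IsMeasureAtom μ (E n) := fun h => hμ ⟨_, h, hEfin n⟩
  simp only [IsMeasureAtom, hE n, pos_iff_ne_zero.mpr hn, true_and, not_forall, not_or] at hnot
  obtain ⟨B, hB, hBE, hB0, hEB0⟩ := hnot
  have hpos : ∀ D, MeasurableSet D → D ⊆ E n → μ D ≠ 0 → 0 < (normMeasure f).real D :=
    fun D hD hDE hD0 => ENNReal.toReal_pos
      (normMeasure_ne_zero f hD hD0 fun x hx => hEf n x (hDE hx)) (measure_ne_top _ _)
  refine ⟨B, hBE.trans inter_subset_left, hB, hpos B hB hBE hB0, ?_⟩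
  exact (hpos _ ((hE n).diff hB) sdiff_subset hEB0).trans_le
    (measureReal_mono (sdiff_subset_sdiff_left inter_subset_left))

/-- The restriction of an integrable function to a measurable set, extended by zero. -/
noncomputable def indicatorL1 (f : Lp 𝕜 1 μ) (A : Set Ω) (hA : MeasurableSet A) : Lp 𝕜 1 μ :=
  ((Lp.memLp f).indicator hA).toLp _

theorem indicatorL1_coeFn (f : Lp 𝕜 1 μ) {A : Set Ω} (hA : MeasurableSet A) :
    indicatorL1 f A hA =ᵐ[μ] A.indicator f := MemLp.coeFn_toLp _

theorem norm_indicatorL1 (f : Lp 𝕜 1 μ) {A : Set Ω} (hA : MeasurableSet A) :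
    ‖indicatorL1 f A hA‖ = (normMeasure f).real A := by
  rw [L1.norm_def, measureReal_def, normMeasure_apply f hA, ← lintegral_indicator hA]
  congr 1
  refine lintegral_congr_ae ?_
  filter_upwards [indicatorL1_coeFn f hA] with x hx
  rw [hx, enorm_indicator_eq_indicator_enorm]

theorem indicatorL1_union (f : Lp 𝕜 1 μ) {A B : Set Ω} (hA : MeasurableSet A)
    (hB : MeasurableSet B) (h : Disjoint A B) :
    indicatorL1 f (A ∪ B) (hA.union hB) = indicatorL1 f A hA + indicatorL1 f B hB := by
  refine Lp.ext ?_
  filter_upwards [indicatorL1_coeFn f hA, indicatorL1_coeFn f hB,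
    indicatorL1_coeFn f (hA.union hB),
    Lp.coeFn_add (indicatorL1 f A hA) (indicatorL1 f B hB)] with x h1 h2 h3 h4
  rw [h4, Pi.add_apply, h1, h2, h3, indicator_union_of_disjoint h]

theorem indicatorL1_univ (f : Lp 𝕜 1 μ) : indicatorL1 f univ .univ = f := by
  refine Lp.ext ?_
  filter_upwards [indicatorL1_coeFn f .univ] with x h1
  rw [h1, indicator_univ]

/-- A functional in the bidual of `L¹(μ)` lives on `A` if it belongs to the bipolar of the space of
integrable functions that vanish off `A`. -/
def LivesOn (F : StrongDual 𝕜 (StrongDual 𝕜 (Lp 𝕜 1 μ))) (A : Set Ω) : Prop :=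
  ∀ ψ : StrongDual 𝕜 (Lp 𝕜 1 μ), (∀ h : Lp 𝕜 1 μ, h =ᵐ[μ.restrict Aᶜ] 0 → ψ h = 0) → F ψ = 0

theorem LivesOn.mono {F : StrongDual 𝕜 (StrongDual 𝕜 (Lp 𝕜 1 μ))} {A B : Set Ω}
    (hF : LivesOn F A) (hAB : A ⊆ B) : LivesOn F B := fun ψ hψ =>
  hF ψ fun h hh => hψ h (ae_restrict_of_ae_restrict_of_subset (compl_subset_compl.mpr hAB) hh)

/-- Test against a norming functional of f restricted to Aᶜ, composed with the restriction: F
annihilates it. -/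
theorem LivesOn.measureReal_compl_le_norm_sub {F : StrongDual 𝕜 (StrongDual 𝕜 (Lp 𝕜 1 μ))}
    {A : Set Ω} (hF : LivesOn F A) (hA : MeasurableSet A) (f : Lp 𝕜 1 μ) :
    (normMeasure f).real Aᶜ ≤ ‖F - inclusionInDoubleDual 𝕜 (Lp 𝕜 1 μ) f‖ := by
  set R := LpToLpRestrictCLM Ω 𝕜 𝕜 μ 1 Aᶜ with hR
  obtain ⟨g, hg, hgf⟩ := exists_dual_vector'' 𝕜 (R f)
  have hRl : ∀ h, ∫⁻ x in Aᶜ, ‖R h x‖ₑ ∂μ = ∫⁻ x in Aᶜ, ‖h x‖ₑ ∂μ := fun h =>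
    lintegral_congr_ae ((LpToLpRestrictCLM_coeFn 𝕜 Aᶜ h).fun_comp (‖·‖ₑ))
  have hRn : ∀ h, ‖R h‖ ≤ ‖h‖ := fun h => by
    rw [L1.norm_def, L1.norm_def, hRl]
    exact ENNReal.toReal_mono (L1.integrable_coeFn h).2.ne (setLIntegral_le_lintegral _ _)
  have hRf : ‖R f‖ = (normMeasure f).real Aᶜ := by
    rw [L1.norm_def, measureReal_def, normMeasure_apply f hA.compl, hRl]
  have hgR : ‖g.comp R‖ ≤ 1 := ContinuousLinearMap.opNorm_le_bound _ zero_le_one fun h =>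
    (g.le_opNorm _).trans (mul_le_mul hg (hRn h) (norm_nonneg _) zero_le_one)
  have hF0 : F (g.comp R) = 0 := hF _ fun h hh => by
    have : R h = 0 := by
      refine Lp.ext ?_
      filter_upwards [LpToLpRestrictCLM_coeFn 𝕜 Aᶜ h, hh, Lp.coeFn_zero 𝕜 1 (μ.restrict Aᶜ)]
        with x h1 h2 h3
      rw [h1, h2, h3]
    rw [ContinuousLinearMap.comp_apply, this, map_zero]
  calc (normMeasure f).real Aᶜ = ‖(F - inclusionInDoubleDual 𝕜 (Lp 𝕜 1 μ) f) (g.comp R)‖ := by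
        rw [_root_.sub_apply, hF0, zero_sub, norm_neg, dual_def,
          ContinuousLinearMap.comp_apply, hgf, RCLike.norm_ofReal, abs_norm, hRf]
    _ ≤ ‖F - inclusionInDoubleDual 𝕜 (Lp 𝕜 1 μ) f‖ * ‖g.comp R‖ :=
        ContinuousLinearMap.le_opNorm _ _
    _ ≤ ‖F - inclusionInDoubleDual 𝕜 (Lp 𝕜 1 μ) f‖ :=
        mul_le_of_le_one_right (ContinuousLinearMap.opNorm_nonneg _) hgR

/-- The functionals in the unit ball of the bidual that live on sets of arbitrarily small
`‖f‖ μ`-measure. -/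
def singularBall (f : Lp 𝕜 1 μ) : Set (StrongDual 𝕜 (StrongDual 𝕜 (Lp 𝕜 1 μ))) :=
  {F | ‖F‖ ≤ 1 ∧ ∀ ε > 0, ∃ A, MeasurableSet A ∧ (normMeasure f).real A < ε ∧ LivesOn F A}

theorem convex_singularBall (f : Lp 𝕜 1 μ) : Convex ℝ (singularBall f) := by
  intro F hF G hG a b ha hb hab
  refine ⟨?_, fun ε hε => ?_⟩
  · exact StrongDual.norm_convexComb_le hF.1 hG.1 ha hb hab
  · obtain ⟨A, hA, hAε, hFA⟩ := hF.2 (ε / 2) (half_pos hε)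
    obtain ⟨B, hB, hBε, hGB⟩ := hG.2 (ε / 2) (half_pos hε)
    refine ⟨A ∪ B, hA.union hB, (measureReal_union_le A B).trans_lt (by linarith),
      fun ψ hψ => ?_⟩
    rw [_root_.add_apply, _root_.smul_apply,
      _root_.smul_apply, hFA.mono subset_union_left ψ hψ,
      hGB.mono subset_union_right ψ hψ, smul_zero, smul_zero, add_zero]

theorem notMem_closure_singularBall {f : Lp 𝕜 1 μ} (hf : f ≠ 0) :
    inclusionInDoubleDual 𝕜 (Lp 𝕜 1 μ) f ∉ closure (singularBall f) := by
  intro h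
  have hpos : 0 < ‖f‖ / 2 := half_pos (norm_pos_iff.mpr hf)
  obtain ⟨F, hF, hFf⟩ := StrongDual.exists_norm_sub_lt_of_mem_closure h hpos
  obtain ⟨A, hA, hAε, hFA⟩ := hF.2 _ hpos
  have h1 := hFA.measureReal_compl_le_norm_sub hA f
  rw [measureReal_compl hA, normMeasure_real_univ] at h1
  linarith

/-- Without atoms of finite measure, no element of the dual separates `f` from the singular
functionals. -/
theorem exists_mem_singularBall_re_le (hμ : ¬ ∃ A : Set Ω, IsMeasureAtom μ A ∧ μ A < ⊤)
    {f : Lp 𝕜 1 μ} (hf : ‖f‖ = 1) (ψ : StrongDual 𝕜 (Lp 𝕜 1 μ)) :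
    ∃ F ∈ singularBall f, RCLike.re (ψ f) ≤ RCLike.re (F ψ) := by
  classical
  set ν := normMeasure f with hν
  set r : ℝ := RCLike.re (ψ f) with hr
  -- σ A ≥ 0 says that f restricted to A and normalised does at least as well against ψ as f. The
  -- value off measurable sets is never used.
  let σ : Set Ω → ℝ := fun A =>
    if hA : MeasurableSet A then RCLike.re (ψ (indicatorL1 f A hA)) - r * ν.real A else 0
  have hσ : ∀ A (hA : MeasurableSet A),
      σ A = RCLike.re (ψ (indicatorL1 f A hA)) - r * ν.real A := fun A hA => dif_pos hA
  have huniv : ν.real univ = 1 := by rw [hν, normMeasure_real_univ, hf]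
  obtain ⟨A, hanti, hA, hlim⟩ := exists_antitone_measureReal_tendsto_zero (ν := ν) (σ := σ)
    (C := ‖ψ‖ + |r|) (by rw [huniv]; exact one_pos)
    (fun A hA h => normMeasure_exists_split hμ f hA h)
    (fun A B hA hB hAB => by
      rw [hσ _ (hA.union hB), hσ _ hA, hσ _ hB, indicatorL1_union f hA hB hAB, map_add, map_add,
        measureReal_union hAB hB]
      ring)
    (fun A hA => by
      rw [hσ _ hA]
      have h1 : |RCLike.re (ψ (indicatorL1 f A hA))| ≤ ‖ψ‖ * ν.real A :=
        (RCLike.abs_re_le_norm _).trans ((ψ.le_opNorm _).trans_eq (by rw [norm_indicatorL1]))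
      calc _ ≤ |RCLike.re (ψ (indicatorL1 f A hA))| + |r * ν.real A| := abs_sub _ _
        _ ≤ ‖ψ‖ * ν.real A + |r| * ν.real A :=
          add_le_add h1 (by rw [abs_mul, abs_of_nonneg (measureReal_nonneg (μ := ν))])
        _ = _ := by ring)
    (by rw [hσ _ .univ, indicatorL1_univ, huniv, mul_one, sub_self])
  -- The normalised restrictions witness that these nested weak-star compact sets are nonempty; a
  -- common point lives on every `A n`.
  let K : ℕ → Set (WeakDual 𝕜 (StrongDual 𝕜 (Lp 𝕜 1 μ))) := fun n =>
    (WeakDual.toStrongDual ⁻¹' Metric.closedBall 0 1) ∩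
      ({F | LivesOn (WeakDual.toStrongDual F) (A n)} ∩ {F | r ≤ RCLike.re (F ψ)})
  have hclosed : ∀ n, IsClosed
      ({F : WeakDual 𝕜 (StrongDual 𝕜 (Lp 𝕜 1 μ)) | LivesOn (WeakDual.toStrongDual F) (A n)} ∩
        {F | r ≤ RCLike.re (F ψ)}) := fun n => by
    refine IsClosed.inter ?_ (isClosed_le continuous_const
      (RCLike.continuous_re.comp (WeakDual.eval_continuous ψ)))
    simp only [LivesOn, ofPred_forall]
    exact isClosed_iInter fun φ => isClosed_iInter fun _ =>
      isClosed_eq (WeakDual.eval_continuous φ) continuous_const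
  have hball := WeakDual.isCompact_closedBall (𝕜 := 𝕜)
    (0 : StrongDual 𝕜 (StrongDual 𝕜 (Lp 𝕜 1 μ))) 1
  have hne : ∀ n, (K n).Nonempty := fun n => by
    obtain ⟨hm, hpos, hnn⟩ := hA n
    set g := indicatorL1 f (A n) hm with hg
    refine ⟨StrongDual.toWeakDual (inclusionInDoubleDual 𝕜 (Lp 𝕜 1 μ)
      (((ν.real (A n))⁻¹ : 𝕜) • g)), ?_, ?_, ?_⟩
    · refine StrongDual.mem_closedBall_zero_iff.mpr ((double_dual_bound 𝕜 _ _).trans_eq ?_)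
      rw [norm_smul, norm_inv, RCLike.norm_ofReal, abs_of_pos hpos, hg, norm_indicatorL1,
        inv_mul_cancel₀ hpos.ne']
    · intro φ hφ
      have h0 : φ g = 0 := hφ g (by
        filter_upwards [ae_restrict_of_ae (indicatorL1_coeFn f hm), ae_restrict_mem hm.compl]
          with x h1 h2
        rw [hg, h1, indicator_of_notMem h2, Pi.zero_apply])
      change φ (((ν.real (A n))⁻¹ : 𝕜) • g) = 0
      rw [map_smul, h0, smul_zero]
    · change r ≤ RCLike.re (ψ (((ν.real (A n))⁻¹ : 𝕜) • g))
      rw [hσ _ hm] at hnn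
      rw [map_smul, smul_eq_mul, ← RCLike.ofReal_inv, RCLike.re_ofReal_mul, inv_mul_eq_div,
        le_div_iff₀ hpos]
      linarith
  obtain ⟨F, hF⟩ := IsCompact.nonempty_iInter_of_sequence_nonempty_isCompact_isClosed K
    (fun n F hF => ⟨hF.1, hF.2.1.mono (hanti (Nat.le_succ n)), hF.2.2⟩) hne
    (hball.inter_right (hclosed 0)) (fun n => hball.isClosed.inter (hclosed n))
  rw [mem_iInter] at hF
  refine ⟨WeakDual.toStrongDual F, ⟨StrongDual.mem_closedBall_zero_iff.mp (hF 0).1, fun ε hε => ?_⟩,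
    (hF 0).2.2⟩
  obtain ⟨n, hn⟩ := (hlim.eventually_lt_const hε).exists
  exact ⟨A n, (hA n).1, hn, (hF n).2.1⟩

end Singular

/-! ### From a continuity point to an atom, and conclusion. -/

theorem exists_isMeasureAtom_of_continuityPoint {𝕜 : Type*} [RCLike 𝕜] {Ω : Type*}
    [MeasurableSpace Ω] {μ : Measure Ω} {f : Lp 𝕜 1 μ} (hf : ‖f‖ = 1)
    (hc : IsWeakStarWeakContinuityPoint 𝕜 (inclusionInDoubleDual 𝕜 (Lp 𝕜 1 μ) f)) :
    ∃ A : Set Ω, IsMeasureAtom μ A ∧ μ A < ⊤ := by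
  by_contra hμ
  refine notMem_closure_singularBall (norm_ne_zero_iff.mp (hf ▸ one_ne_zero))
    (hc.mem_closure (convex_singularBall f) (fun F hF => StrongDual.mem_closedBall_zero_iff.mpr hF.1)
      fun ψ => exists_mem_singularBall_re_le hμ hf ψ)

theorem mainTheorem5 {𝕜 : Type*} [RCLike 𝕜] {Ω : Type*} [MeasurableSpace Ω] (μ : Measure Ω)
    (hΛ : ∃ Λ : Lp 𝕜 1 μ, ‖Λ‖ = 1 ∧
      IsWeakStarWeakContinuityPoint 𝕜 (inclusionInDoubleDual 𝕜 (Lp 𝕜 1 μ) Λ)) :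
    (∃ A : Set Ω, IsMeasureAtom μ A ∧ μ A < ⊤) ∧
    ∃ e : Lp 𝕜 1 μ, ‖e‖ = 1 ∧
      e ∈ extremePoints ℝ (Metric.closedBall (0 : Lp 𝕜 1 μ) 1) ∧
      inclusionInDoubleDual 𝕜 (Lp 𝕜 1 μ) e ∈
        extremePoints ℝ
          (Metric.closedBall (0 : StrongDual 𝕜 (StrongDual 𝕜 (Lp 𝕜 1 μ))) 1) ∧
      IsWeakStarWeakContinuityPoint 𝕜 (inclusionInDoubleDual 𝕜 (Lp 𝕜 1 μ) e) := by
  obtain ⟨Λ, hΛ1, hΛc⟩ := hΛ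
  obtain ⟨A, hA, hfin⟩ := exists_isMeasureAtom_of_continuityPoint hΛ1 hΛc
  exact ⟨⟨A, hA, hfin⟩, hA.exists_extremePoint hfin.ne⟩
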